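/- Let $f,g:2^\omega\to\mathbb R$ be Baire 1 functions (pointwise limits of sequences of continuous functions) that are not continuous. Then $f\leq_{\mathbf{tt}} g$ if and only if $|f|_\alpha\lesssim|g|_\alpha$. Equivalently, $f\leq_{\mathbf{tt}} g$ if and only if $\xi(f)\leq\xi(g)$, where $\xi(f)$ is the least ordinal $\xi$ with $|f|_\alpha\leq\omega^{\xi}$; so two such functions are $\mathbf{tt}$-equivalent exactly when their ranks lie in the same level $\omega^\xi$. Here the notions are as follows. For $y\in\mathbb R$ and rationals $p$ and $\varepsilon>0$, the answer $1$ to the question "$y\lesssim_\varepsilon p$?" is correct if $y<p+\varepsilon$, and the answer $0$ is correct if $y>p-\varepsilon$. We write $f\leq_{\mathbf{tt}} g$ if for all rationals $p$ and $\varepsilon>0$ there are $r\in\omega$, rationals $q_i$ and $\delta_i>0$ $(i<r)$, continuous functions $k_i:2^\omega\to2^\omega$ $(i<r)$ and $h:2^r\to\{0,1\}$ such that for every $A\in2^\omega$ and every $\sigma\in2^r$: if each $\sigma(i)$ correctly answers $g(k_i(A))\lesssim_{\delta_i}q_i$, then $h(\sigma)$ correctly answers $f(A)\lesssim_\varepsilon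 p$. For rationals $p$ and $\varepsilon>0$ let $\mathcal C=\{f^{-1}((-\infty,p+\varepsilon)),\,f^{-1}((p-\varepsilon,\infty))\}$, and define closed sets $P^\nu$ by $P^0=2^\omega$, $P^{\nu+1}=P^\nu\setminus\bigcup\{U\text{ open}: P^\nu\cap U\subseteq C\text{ for some }C\in\mathcal C\}$, and $P^\lambda=\bigcap_{\nu<\lambda}P^\nu$ for limit $\lambda$. Let $\alpha(f,p,\varepsilon)$ be the least $\nu$ with $P^\nu=\emptyset$ (it exists because $f$ is Baire 1). The Bourgain rank of $f$ is $|f|_\alpha=\sup_{p,\varepsilon}\alpha(f,p,\varepsilon)$. For ordinals $\alpha,\beta$, $\alpha\lesssim\beta$ means that for every $\gamma<\alpha$ there are $\delta<\beta$ and $n\in\omega$ with $\gamma<\delta\cdot n$. -/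

import Mathlib

namespace Bourgain

open Set Filter Topology

/-- Cantor space `2^ω` with the product topology. -/
abbrev Cantor : Type := ℕ → Bool

/-- `b` is a correct answer to the question "`y ≲_ε p`?": the answer "yes" (`true`) is correct if
`y < p + ε`, and the answer "no" (`false`) is correct if `y > p - ε`. -/
def CorrectAnswer (b : Bool) (y : ℝ) (p ε : ℚ) : Prop :=
  (b = true ∧ y < (p : ℝ) + (ε : ℝ)) ∨ (b = false ∧ (p : ℝ) - (ε : ℝ) < y)

/-- Topological truth-table reducibility `f ≤_tt g` for functions on Cantor space. -/
def TTReducible (f g : Cantor → ℝ) : Prop :=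
  ∀ p ε : ℚ, 0 < ε →
    ∃ (r : ℕ) (q δ : Fin r → ℚ) (k : Fin r → Cantor → Cantor) (h : (Fin r → Bool) → Bool),
      (∀ i, 0 < δ i) ∧ (∀ i, Continuous (k i)) ∧
      ∀ (A : Cantor) (σ : Fin r → Bool),
        (∀ i, CorrectAnswer (σ i) (g (k i A)) (q i) (δ i)) → CorrectAnswer (h σ) (f A) p ε

/-- `f` is a Baire 1 function: a pointwise limit of a sequence of continuous functions. -/
def IsBaireOne {X : Type*} [TopologicalSpace X] (f : X → ℝ) : Prop :=
  ∃ F : ℕ → X → ℝ, (∀ n, Continuous (F n)) ∧ ∀ x, Tendsto (fun n => F n x) atTop (𝓝 (f x))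

/-- One derivation step: remove from `P` every open `U` with `P ∩ U ⊆ C` for some `C ∈ 𝒞`. -/
def derive {X : Type*} [TopologicalSpace X] (𝒞 : Set (Set X)) (P : Set X) : Set X :=
  P \ ⋃₀ {U | IsOpen U ∧ ∃ C ∈ 𝒞, P ∩ U ⊆ C}

/-- The optimal derivation sequence `P^ν` for `𝒞`: `P^0 = X`, `P^{ν+1} = derive 𝒞 P^ν`, and
intersections at limits. -/
noncomputable def derivSeq {X : Type*} [TopologicalSpace X] (𝒞 : Set (Set X))
    (ν : Ordinal.{0}) : Set X :=
  Ordinal.limitRecOn (motive := fun _ => Set X) ν Set.univ (fun _ P => derive 𝒞 P)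
    (fun l _ P => ⋂ (μ : Ordinal.{0}) (hμ : μ < l), P μ hμ)

theorem derivSeq_zero {X : Type*} [TopologicalSpace X] (𝒞 : Set (Set X)) :
    derivSeq 𝒞 0 = Set.univ := by
  simp [derivSeq]

theorem derivSeq_succ {X : Type*} [TopologicalSpace X] (𝒞 : Set (Set X)) (ν : Ordinal.{0}) :
    derivSeq 𝒞 (Order.succ ν) = derive 𝒞 (derivSeq 𝒞 ν) := by
  simp [derivSeq]

theorem derivSeq_limit {X : Type*} [TopologicalSpace X] (𝒞 : Set (Set X)) (l : Ordinal.{0})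
    (hl : Order.IsSuccLimit l) :
    derivSeq 𝒞 l = ⋂ (μ : Ordinal.{0}) (_ : μ < l), derivSeq 𝒞 μ := by
  simp only [derivSeq]
  rw [Ordinal.limitRecOn_limit _ _ _ _ hl]

/-- The two sets `f⁻¹((-∞, p + ε))` and `f⁻¹((p - ε, ∞))`. -/
def separatingSets {X : Type*} (f : X → ℝ) (p ε : ℚ) : Set (Set X) :=
  {f ⁻¹' Set.Iio ((p : ℝ) + (ε : ℝ)), f ⁻¹' Set.Ioi ((p : ℝ) - (ε : ℝ))}

/-- `α(f, p, ε)`: the least `ν` with `P^ν_{f,p,ε} = ∅`. On a compact metrizable space such a `ν`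
exists for every Baire 1 function `f` and every `ε > 0`. -/
noncomputable def rankAt {X : Type*} [TopologicalSpace X] (f : X → ℝ) (p ε : ℚ) : Ordinal.{0} :=
  sInf {ν : Ordinal.{0} | derivSeq (separatingSets f p ε) ν = ∅}

/-- The Bourgain rank `|f|_α`: the supremum of `α(f, p, ε)` over rational `p` and rational
`ε > 0`. -/
noncomputable def bourgainRank {X : Type*} [TopologicalSpace X] (f : X → ℝ) : Ordinal.{0} :=
  ⨆ t : ℚ × {ε : ℚ // 0 < ε}, rankAt f t.1 (t.2 : ℚ)

/-- `α ≲ β`: every `γ < α` lies below `δ · n` for some `δ < β` and some natural number `n`. -/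
def OrdLesssim (α β : Ordinal.{0}) : Prop :=
  ∀ γ < α, ∃ δ < β, ∃ n : ℕ, γ < δ * (n : Ordinal.{0})

/-- `ξ(f)`: the least `ξ` with `|f|_α ≤ ω^ξ`. -/
noncomputable def bourgainLevel {X : Type*} [TopologicalSpace X] (f : X → ℝ) : Ordinal.{0} :=
  sInf {ξ : Ordinal.{0} | bourgainRank f ≤ Ordinal.omega0 ^ ξ}

end Bourgain

/-!
Write `F^ν` and `G^ν` for the derivation sequences of `f` and `g` (for given `p, ε` and `q, δ`).
For Baire 1 functions they terminate, by the Baire category theorem (`IsBaireOne.derive_ne`), and by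
compactness they do so at a successor stage (`IsBaireOne.exists_succ_eq_empty`). Since a function
that is not continuous has rank at least `2`, both `|f|_α ≲ |g|_α` and `ξ(f) ≤ ξ(g)` say that
`|f|_α ≤ ω^ξ(g)` (`ordLesssim_iff_le_opow_level`, `level_le_iff`).

*From ranks to reductions* (`TTReducible.of_ordLesssim`). A point of `G^(ρ+1)` is a limit of points
of `G^ρ` at which the answer `true` to the question about `g` is wrong, and of points at which
`false` is wrong. Hence, if `G^κ` is nonempty, a continuous map into the domain of `g` can follow
the removal of its argument from the sets `F^(θ+ρ)`, `ρ < κ`, moving its value to a nearby point of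
`G^ρ` that forces the current answer about `f` (`exists_simulation`). If `F^(κ·n)` is empty, then
`n` such maps cover the whole derivation of `f`, and `n` further queries, each with a single possible
change of mind, tell which of them to believe (`exists_query_mem_closed`). The continuous maps
are all produced by one gluing principle, `exists_continuous_glue`.

*From reductions to ranks* (`TTReducible.bourgainRank_le`). Given a truth-table reduction with inner
maps `k i`, let `N A` be the natural (Hessenberg) sum over `i` of the stages at which the points
`k i A` are removed. Near `A` each of these stages can only drop, and where none drops, one tuple of
answers is correct throughout. By induction on `N A`, `A` is not in `F^(N A + 1)`. Powers of `ω`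
are closed under natural sums (`natSum_lt_omega0_opow`), so `|f|_α ≤ ω^ξ` whenever `|g|_α ≤ ω^ξ`.
-/

namespace Bourgain

open Set Filter Topology Order

/-! ### Answers and derivatives -/

theorem correctAnswer_true {y : ℝ} {p ε : ℚ} : CorrectAnswer true y p ε ↔ y < (p : ℝ) + ε := by
  simp [CorrectAnswer]

theorem correctAnswer_false {y : ℝ} {p ε : ℚ} : CorrectAnswer false y p ε ↔ (p : ℝ) - ε < y := by
  simp [CorrectAnswer]

/-- The two sets in `separatingSets f p ε` are those on which a given answer is correct, so a point
survives a derivation step iff each of the two answers is wrong arbitrarily close to it. -/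
theorem mem_derive_iff {X : Type*} [TopologicalSpace X] {f : X → ℝ} {p ε : ℚ} {P : Set X} {A : X} :
    A ∈ derive (separatingSets f p ε) P ↔
      A ∈ P ∧ ∀ b, ∃ᶠ B in 𝓝 A, B ∈ P ∧ ¬ CorrectAnswer b (f B) p ε := by
  have key : ∀ b, (¬ ∃ᶠ B in 𝓝 A, B ∈ P ∧ ¬ CorrectAnswer b (f B) p ε) ↔
      ∃ U, IsOpen U ∧ A ∈ U ∧ P ∩ U ⊆ {B | CorrectAnswer b (f B) p ε} := by
    intro b
    rw [not_frequently, eventually_nhds_iff]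
    constructor
    · rintro ⟨U, h, hU, hA⟩
      exact ⟨U, hU, hA, fun B hB => by simpa [hB.1] using h B hB.2⟩
    · rintro ⟨U, hU, hA, h⟩
      exact ⟨U, fun B hB hn => hn.2 (h ⟨hn.1, hB⟩), hU, hA⟩
  have h1 : {B | CorrectAnswer true (f B) p ε} = f ⁻¹' Iio ((p : ℝ) + ε) := by
    ext; simp [correctAnswer_true]
  have h2 : {B | CorrectAnswer false (f B) p ε} = f ⁻¹' Ioi ((p : ℝ) - ε) := by
    ext; simp [correctAnswer_false]
  rw [derive, Set.mem_sdiff, and_congr_right_iff]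
  intro _
  rw [← not_iff_not, not_not, not_forall, Bool.exists_bool, key, key, h1, h2]
  simp only [mem_sUnion, mem_ofPred_eq, separatingSets, mem_insert_iff, mem_singleton_iff,
    exists_eq_or_imp, exists_eq_left]
  constructor
  · rintro ⟨U, ⟨hU, h | h⟩, hA⟩
    · exact Or.inr ⟨U, hU, hA, h⟩
    · exact Or.inl ⟨U, hU, hA, h⟩
  · rintro (⟨U, hU, hA, h⟩ | ⟨U, hU, hA, h⟩)
    · exact ⟨U, ⟨hU, Or.inr h⟩, hA⟩
    · exact ⟨U, ⟨hU, Or.inl h⟩, hA⟩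

section Derivation

variable {X : Type*} [TopologicalSpace X] {𝒞 : Set (Set X)}

theorem derive_subset {P : Set X} : derive 𝒞 P ⊆ P := sdiff_subset

theorem isClosed_derive {P : Set X} (hP : IsClosed P) : IsClosed (derive 𝒞 P) :=
  hP.sdiff (isOpen_sUnion fun _ h => h.1)

theorem isClosed_derivSeq (ν : Ordinal.{0}) : IsClosed (derivSeq 𝒞 ν) := by
  induction ν using Ordinal.limitRecOn with
  | zero => rw [derivSeq_zero]; exact isClosed_univ
  | add_one ν ih => rw [← Order.succ_eq_add_one, derivSeq_succ]; exact isClosed_derive ih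
  | limit l hl ih =>
    rw [derivSeq_limit _ _ hl]
    exact isClosed_iInter fun μ => isClosed_iInter fun hμ => ih μ hμ

theorem derivSeq_antitone : Antitone (derivSeq 𝒞) := by
  intro a b hab
  induction b using Ordinal.limitRecOn with
  | zero => rw [nonpos_iff_eq_zero.1 hab]
  | add_one b ih =>
    rw [← Order.succ_eq_add_one] at hab ⊢
    rcases hab.eq_or_lt with rfl | h
    · exact le_rfl
    · rw [derivSeq_succ]
      exact derive_subset.trans (ih (Order.lt_succ_iff.1 h))
  | limit l hl ih =>
    rcases hab.eq_or_lt with rfl | h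
    · exact le_rfl
    · rw [derivSeq_limit _ _ hl]
      exact iInter₂_subset a h

/-- Every point outside `P^ν` is removed at a definite stage `μ < ν`. -/
theorem exists_removal_stage {ν : Ordinal.{0}} {A : X} (h : A ∉ derivSeq 𝒞 ν) :
    ∃ μ < ν, A ∈ derivSeq 𝒞 μ ∧ A ∉ derivSeq 𝒞 (Order.succ μ) := by
  induction ν using Ordinal.limitRecOn with
  | zero => simp [derivSeq_zero] at h
  | add_one ν ih =>
    rw [← Order.succ_eq_add_one] at h ⊢
    by_cases hν : A ∈ derivSeq 𝒞 ν
    · exact ⟨ν, Order.lt_succ ν, hν, h⟩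
    · obtain ⟨μ, hμ, h'⟩ := ih hν
      exact ⟨μ, hμ.trans (Order.lt_succ ν), h'⟩
  | limit l hl ih =>
    rw [derivSeq_limit _ _ hl] at h
    simp only [mem_iInter, not_forall] at h
    obtain ⟨μ, hμ, h⟩ := h
    obtain ⟨κ, hκ, h'⟩ := ih μ hμ h
    exact ⟨κ, hκ.trans hμ, h'⟩

theorem exists_derivSeq_eq_empty_of_limit [CompactSpace X] {l : Ordinal.{0}}
    (hl : Order.IsSuccLimit l) (h : derivSeq 𝒞 l = ∅) : ∃ μ < l, derivSeq 𝒞 μ = ∅ := by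
  by_contra! hne
  have hl0 : 0 < l := hl.bot_lt
  have : Nonempty (Iio l) := ⟨⟨0, hl0⟩⟩
  have := IsCompact.nonempty_iInter_of_directed_nonempty_isCompact_isClosed
    (fun μ : Iio l => derivSeq 𝒞 μ.1)
    (directed_of_isDirected_le fun a b hab => derivSeq_antitone hab)
    (fun μ => hne μ.1 μ.2) (fun μ => (isClosed_derivSeq _).isCompact)
    (fun μ => isClosed_derivSeq _)
  obtain ⟨x, hx⟩ := this
  have hx' : x ∈ derivSeq 𝒞 l := by
    rw [derivSeq_limit _ _ hl]
    simpa using hx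
  exact notMem_empty x (h ▸ hx')

/-- The derivation of a family that strictly shrinks every nonempty closed set terminates, since
the ordinals do not inject into a small type. -/
theorem exists_derivSeq_eq_empty {X : Type} [TopologicalSpace X] {𝒞 : Set (Set X)}
    (h : ∀ P : Set X, IsClosed P → P.Nonempty → derive 𝒞 P ≠ P) :
    ∃ ν : Ordinal.{0}, derivSeq 𝒞 ν = ∅ := by
  by_contra! hne
  refine not_injective_of_ordinal (derivSeq 𝒞) (.of_lt_imp_ne fun a b hab heq => ?_)
  refine h _ (isClosed_derivSeq a) (hne a) (derive_subset.antisymm ?_)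
  rw [← derivSeq_succ, heq]
  exact derivSeq_antitone (Order.succ_le_of_lt hab)

end Derivation

/-! ### Termination for Baire 1 functions -/

/-- By the Baire category theorem, on a nonempty closed set `P` some approximating function `F N`
is uniformly close to `f` on a relatively open set, so one answer is correct on a smaller one. -/
theorem IsBaireOne.derive_ne {X : Type*} [TopologicalSpace X] [CompactSpace X] [T2Space X]
    {f : X → ℝ} (hf : IsBaireOne f) {p ε : ℚ} (hε : 0 < ε) {P : Set X} (hP : IsClosed P)
    (hne : P.Nonempty) : derive (separatingSets f p ε) P ≠ P := by
  obtain ⟨F, hF, hlim⟩ := hf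
  have : CompactSpace P := isCompact_iff_compactSpace.1 hP.isCompact
  have : Nonempty P := hne.to_subtype
  have hε' : (0 : ℝ) < ε / 2 := by
    have : (0 : ℝ) < ε := by exact_mod_cast hε
    linarith
  let S : ℕ → Set P := fun N => ⋂ m ≥ N, {x : P | |F m x - F N x| ≤ (ε : ℝ) / 2}
  have hS : ∀ N, IsClosed (S N) := fun N => isClosed_iInter fun m => isClosed_iInter fun _ => by
    have h1 := hF m
    have h2 := hF N
    exact isClosed_le (by fun_prop) continuous_const
  have hU : ⋃ N, S N = univ := by
    refine eq_univ_of_forall fun x => ?_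
    obtain ⟨N, hN⟩ := Metric.cauchySeq_iff'.1 (hlim x).cauchySeq _ hε'
    refine mem_iUnion.2 ⟨N, ?_⟩
    simp only [S, mem_iInter, mem_ofPred_eq]
    exact fun m hm => (hN m hm).le
  obtain ⟨N, x, hx⟩ := nonempty_interior_of_iUnion_of_closed hS hU
  obtain ⟨V, hV, hVe⟩ := isOpen_induced_iff.1 (isOpen_interior (s := S N))
  intro heq
  have hxP : (x : X) ∈ derive (separatingSets f p ε) P := heq.symm ▸ x.2
  have hxV : V ∈ 𝓝 (x : X) := hV.mem_nhds (by rw [← hVe] at hx; exact hx)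
  have hclose : ∀ B ∈ V, B ∈ P → |f B - F N B| ≤ (ε : ℝ) / 2 := by
    intro B hB hBP
    have hmem : (⟨B, hBP⟩ : P) ∈ S N := by
      apply interior_subset
      rw [← hVe]
      exact hB
    refine le_of_tendsto (((hlim B).sub_const (F N B)).abs) ?_
    filter_upwards [eventually_ge_atTop N] with m hm
    simp only [S, mem_iInter, mem_ofPred_eq] at hmem
    exact hmem m hm
  have hfr := (mem_derive_iff.1 hxP).2
  rcases lt_or_ge (F N x) p with hlt | hge
  · have hnear : ∀ᶠ B in 𝓝 (x : X), F N B < (p : ℝ) + ε / 2 :=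
      (hF N).continuousAt.eventually_lt_const (by linarith)
    obtain ⟨B, ⟨hB, hn⟩, hB1, hB2⟩ := ((hfr true).and_eventually (hnear.and hxV)).exists
    rw [correctAnswer_true] at hn
    have := (abs_le.1 (hclose B hB2 hB)).2
    linarith
  · have hnear : ∀ᶠ B in 𝓝 (x : X), (p : ℝ) - ε / 2 < F N B :=
      (hF N).continuousAt.eventually_const_lt (by linarith)
    obtain ⟨B, ⟨hB, hn⟩, hB1, hB2⟩ := ((hfr false).and_eventually (hnear.and hxV)).exists
    rw [correctAnswer_false] at hn
    have := (abs_le.1 (hclose B hB2 hB)).1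
    linarith

section Rank

variable {X : Type} [TopologicalSpace X] [CompactSpace X] [T2Space X] {f : X → ℝ}

theorem IsBaireOne.rankAt_le_iff (hf : IsBaireOne f) {p ε : ℚ} (hε : 0 < ε) {ν : Ordinal.{0}} :
    rankAt f p ε ≤ ν ↔ derivSeq (separatingSets f p ε) ν = ∅ := by
  have hne : {ν : Ordinal.{0} | derivSeq (separatingSets f p ε) ν = ∅}.Nonempty :=
    exists_derivSeq_eq_empty fun P hP hPne => hf.derive_ne hε hP hPne
  refine ⟨fun h => ?_, fun h => csInf_le' h⟩
  have h0 : derivSeq (separatingSets f p ε) (rankAt f p ε) = ∅ := csInf_mem hne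
  exact subset_empty_iff.1 (h0 ▸ derivSeq_antitone h)

theorem rankAt_le_bourgainRank {X : Type} [TopologicalSpace X] (f : X → ℝ) (p : ℚ) {ε : ℚ}
    (hε : 0 < ε) :
    rankAt f p ε ≤ bourgainRank f :=
  Ordinal.le_iSup (fun t : ℚ × {ε : ℚ // 0 < ε} => rankAt f t.1 (t.2 : ℚ)) (p, ⟨ε, hε⟩)

theorem IsBaireOne.derivSeq_bourgainRank (hf : IsBaireOne f) (p : ℚ) {ε : ℚ} (hε : 0 < ε) :
    derivSeq (separatingSets f p ε) (bourgainRank f) = ∅ :=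
  (hf.rankAt_le_iff hε).1 (rankAt_le_bourgainRank f p hε)

theorem IsBaireOne.exists_nonempty_of_lt (hf : IsBaireOne f) {ν : Ordinal.{0}}
    (h : ν < bourgainRank f) :
    ∃ p ε : ℚ, 0 < ε ∧ (derivSeq (separatingSets f p ε) ν).Nonempty := by
  obtain ⟨⟨p, ε, hε⟩, h⟩ := Ordinal.lt_iSup_iff.1 h
  refine ⟨p, ε, hε, ?_⟩
  rw [nonempty_iff_ne_empty, Ne, ← hf.rankAt_le_iff hε, not_le]
  exact h

/-- By compactness `α(f, p, ε)` is a successor ordinal, so the derivation is exhausted right after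
some stage strictly below the rank. -/
theorem IsBaireOne.exists_succ_eq_empty [Nonempty X] (hf : IsBaireOne f) (p : ℚ) {ε : ℚ}
    (hε : 0 < ε) :
    ∃ α < bourgainRank f, derivSeq (separatingSets f p ε) (Order.succ α) = ∅ := by
  have h0 := (hf.rankAt_le_iff (p := p) hε).1 le_rfl
  have hle := rankAt_le_bourgainRank f p hε
  rcases Ordinal.zero_or_succ_or_isSuccLimit (rankAt f p ε) with h | ⟨α, h⟩ | h
  · rw [h, derivSeq_zero] at h0
    exact absurd h0 univ_nonempty.ne_empty
  · rw [← h] at h0 hle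
    exact ⟨α, (Order.lt_succ α).trans_le hle, h0⟩
  · obtain ⟨μ, hμ, h'⟩ := exists_derivSeq_eq_empty_of_limit h h0
    exact absurd ((hf.rankAt_le_iff hε).2 h') hμ.not_ge

end Rank

/-! ### Building continuous reductions -/

/-- Gluing principle. If every point outside a closed set `E` has a neighbourhood on which the
relation `R` is uniformized by continuous functions taking values arbitrarily close to `x₀`, then
`R` is uniformized on all of `Eᶜ` by a continuous function that sends `E` to `x₀`. -/
theorem exists_continuous_glue {E : Set Cantor} (hE : IsClosed E) (x₀ : Cantor)
    (R : Cantor → Cantor → Prop)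
    (hR : ∀ A ∉ E, ∃ U ∈ 𝓝 A, ∀ l, ∃ K : Cantor → Cantor, Continuous K ∧
      (∀ B, K B ∈ PiNat.cylinder x₀ l) ∧ ∀ B ∈ U, R (K B) B) (n : ℕ) :
    ∃ k : Cantor → Cantor, Continuous k ∧ (∀ B ∈ E, k B = x₀) ∧
      (∀ B, k B ∈ PiNat.cylinder x₀ n) ∧ ∀ B ∉ E, R (k B) B := by
  classical
  let Good : Set Cantor → Prop := fun C => Disjoint C E ∧ ∀ l, ∃ K : Cantor → Cantor,
    Continuous K ∧ (∀ B, K B ∈ PiNat.cylinder x₀ l) ∧ ∀ B ∈ C, R (K B) B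
  have hgood : ∀ A, A ∉ E → ∃ l, Good (PiNat.cylinder A l) := by
    intro A hA
    obtain ⟨U, hU, h⟩ := hR A hA
    obtain ⟨V, hVU, hV, hAV⟩ := mem_nhds_iff.1 (inter_mem hU (hE.isOpen_compl.mem_nhds hA))
    obtain ⟨_, ⟨x, l, rfl⟩, hAx, hx⟩ :=
      (PiNat.isTopologicalBasis_cylinders fun _ : ℕ => Bool).exists_subset_of_mem_open hAV hV
    rw [← PiNat.mem_cylinder_iff_eq.1 hAx] at hx
    refine ⟨l, disjoint_left.2 fun B hB => (hVU (hx hB)).2, fun m => ?_⟩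
    obtain ⟨K, h1, h2, h3⟩ := h m
    exact ⟨K, h1, h2, fun B hB => h3 B (hVU (hx hB)).1⟩
  have hgoodE : ∀ A ∈ E, ∀ l, ¬ Good (PiNat.cylinder A l) := fun A hA l h =>
    disjoint_left.1 h.1 (PiNat.self_mem_cylinder A l) hA
  have hK : ∀ (C : Set Cantor) (l : ℕ), ∃ K : Cantor → Cantor, Good C →
      Continuous K ∧ (∀ B, K B ∈ PiNat.cylinder x₀ l) ∧ ∀ B ∈ C, R (K B) B := by
    intro C l
    by_cases h : Good C
    · exact (h.2 l).imp fun K hK _ => hK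
    · exact ⟨id, fun h' => absurd h' h⟩
  choose K hK using hK
  -- `len A` is the first moment at which the initial segment of `A` witnesses `A ∉ E`.
  let len : Cantor → ℕ := fun A => sInf {l | Good (PiNat.cylinder A l)}
  have hlen : ∀ A, A ∉ E → Good (PiNat.cylinder A (len A)) := fun A hA => Nat.sInf_mem (hgood A hA)
  let k : Cantor → Cantor := fun A =>
    if A ∈ E then x₀ else K (PiNat.cylinder A (len A)) (max n (len A)) A
  have hkE : ∀ B ∈ E, k B = x₀ := fun B hB => if_pos hB
  have hk : ∀ B, B ∉ E → k B = K (PiNat.cylinder B (len B)) (max n (len B)) B :=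
    fun B hB => if_neg hB
  have hkcyl : ∀ B, B ∉ E → k B ∈ PiNat.cylinder x₀ (max n (len B)) := by
    intro B hB
    rw [hk B hB]
    exact (hK _ _ (hlen B hB)).2.1 B
  refine ⟨k, continuous_iff_continuousAt.2 fun A => ?_, hkE, fun B => ?_, fun B hB => ?_⟩
  · have hcyl : ∀ l, PiNat.cylinder A l ∈ 𝓝 A := fun l =>
      (PiNat.isOpen_cylinder _ A l).mem_nhds (PiNat.self_mem_cylinder A l)
    by_cases hA : A ∈ E
    · -- Points agreeing with `A` up to `l` leave `E` only after stage `l`, hence stay near `x₀`.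
      rw [ContinuousAt, hkE A hA]
      refine ((PiNat.isTopologicalBasis_cylinders fun _ : ℕ => Bool).nhds_hasBasis
        (a := x₀)).tendsto_right_iff.2 ?_
      rintro _ ⟨⟨x, l, rfl⟩, hx⟩
      rw [← PiNat.mem_cylinder_iff_eq.1 hx]
      filter_upwards [hcyl l] with B hB
      by_cases hBE : B ∈ E
      · rw [hkE B hBE]
        exact PiNat.self_mem_cylinder _ _
      · refine PiNat.cylinder_anti x₀ ?_ (hkcyl B hBE)
        by_contra! hlt
        have hle : len B ≤ l := (le_max_right n _).trans hlt.le
        have heq : PiNat.cylinder B (len B) = PiNat.cylinder A (len B) :=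
          PiNat.mem_cylinder_iff_eq.1 (PiNat.cylinder_anti A hle hB)
        exact hgoodE A hA _ (heq ▸ hlen B hBE)
    · have hcont := (hK _ (max n (len A)) (hlen A hA)).1
      refine hcont.continuousAt.congr ?_
      filter_upwards [hcyl (len A)] with B hB
      have heq : ∀ l ≤ len A, PiNat.cylinder B l = PiNat.cylinder A l := fun l hl =>
        PiNat.mem_cylinder_iff_eq.1 (PiNat.cylinder_anti A hl hB)
      have hBE : B ∉ E := fun h => hgoodE B h (len A) ((heq _ le_rfl).symm ▸ hlen A hA)
      have hle : len B ≤ len A :=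
        Nat.sInf_le (show Good _ from (heq _ le_rfl).symm ▸ hlen A hA)
      have hge : len A ≤ len B :=
        Nat.sInf_le (show Good _ from heq _ hle ▸ hlen B hBE)
      rw [hk B hBE, le_antisymm hle hge, heq _ le_rfl]
  · by_cases hB : B ∈ E
    · rw [hkE B hB]
      exact PiNat.self_mem_cylinder _ _
    · exact PiNat.cylinder_anti x₀ (le_max_left _ _) (hkcyl B hB)
  · rw [hk B hB]
    exact (hK _ _ (hlen B hB)).2.2 B (PiNat.self_mem_cylinder _ _)

/-- A single query to `g` simulates `f` over `κ` stages of its derivation, provided that `g`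
survives `κ` stages. While the input stays in `F^(θ+κ)` the image stays at `x₀ ∈ G^κ`. Near an input
that lies in `F^(θ+ρ)` but not in `F^(θ+ρ+1)`, where `ρ < κ`, one answer `b` is correct for all
members of `F^(θ+ρ)`; since `x₀ ∈ G^(ρ+1)`, the image can move to a nearby point of `G^ρ` at which
the answer `!b` is wrong for `g`. From there the construction continues by induction, with `ρ` in
place of `κ`, in case the input also leaves `F^(θ+ρ)`. -/
theorem exists_simulation (f g : Cantor → ℝ) (p ε q δ : ℚ) (θ κ : Ordinal.{0}) (x₀ : Cantor)
    (hx₀ : x₀ ∈ derivSeq (separatingSets g q δ) κ) (n : ℕ) :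
    ∃ k : Cantor → Cantor, Continuous k ∧
      (∀ B ∈ derivSeq (separatingSets f p ε) (θ + κ), k B = x₀) ∧
      (∀ B, k B ∈ PiNat.cylinder x₀ n) ∧
      ∀ B ∉ derivSeq (separatingSets f p ε) (θ + κ), B ∈ derivSeq (separatingSets f p ε) θ →
        ∃ b, CorrectAnswer b (f B) p ε ∧ ¬ CorrectAnswer (!b) (g (k B)) q δ := by
  induction κ using WellFoundedLT.induction generalizing x₀ n with
  | ind κ ih =>
  refine exists_continuous_glue (isClosed_derivSeq _) x₀
    (fun y B => B ∈ derivSeq (separatingSets f p ε) θ →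
        ∃ b, CorrectAnswer b (f B) p ε ∧ ¬ CorrectAnswer (!b) (g y) q δ) (fun A hA => ?_) n
  by_cases hθ : A ∈ derivSeq (separatingSets f p ε) θ
  · obtain ⟨μ, hμ, hAμ, hAs⟩ := exists_removal_stage hA
    have hθμ : θ ≤ μ := by
      by_contra! h
      exact hAs (derivSeq_antitone (Order.succ_le_of_lt h) hθ)
    obtain ⟨ρ, rfl⟩ := exists_add_of_le hθμ
    have hρ : ρ < κ := lt_of_add_lt_add_left hμ
    rw [derivSeq_succ, mem_derive_iff] at hAs
    push Not at hAs
    obtain ⟨b, hb⟩ := hAs hAμ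
    refine ⟨_, hb, fun l => ?_⟩
    have hx₀' := derivSeq_antitone (Order.succ_le_of_lt hρ) hx₀
    rw [derivSeq_succ, mem_derive_iff] at hx₀'
    obtain ⟨x, ⟨hxρ, hxb⟩, hxl⟩ := ((hx₀'.2 (!b)).and_eventually
      ((PiNat.isOpen_cylinder _ x₀ l).mem_nhds (PiNat.self_mem_cylinder x₀ l))).exists
    obtain ⟨K, hK, hKx, hKl, hKR⟩ := ih ρ hρ x hxρ l
    refine ⟨K, hK, fun B => PiNat.mem_cylinder_iff_eq.1 hxl ▸ hKl B, fun B hB hBθ => ?_⟩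
    by_cases hBρ : B ∈ derivSeq (separatingSets f p ε) (θ + ρ)
    · exact ⟨b, hB hBρ, by rwa [hKx B hBρ]⟩
    · exact hKR B hBρ hBθ
  · exact ⟨_, (isClosed_derivSeq _).isOpen_compl.mem_nhds hθ, fun l => ⟨fun _ => x₀,
      continuous_const, fun _ => PiNat.self_mem_cylinder _ _, fun B hB h => absurd h hB⟩⟩

/-- At a point of discontinuity one answer is refuted, while the opposite answer is refuted at
points arbitrarily close by. -/
theorem exists_frequently_refuted {X : Type*} [TopologicalSpace X] {g : X → ℝ}
    (hg : ¬ Continuous g) : ∃ q δ : ℚ, 0 < δ ∧ ∃ x b, ¬ CorrectAnswer b (g x) q δ ∧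
      ∃ᶠ y in 𝓝 x, ¬ CorrectAnswer (!b) (g y) q δ := by
  rw [continuous_iff_continuousAt, not_forall] at hg
  obtain ⟨x, hx⟩ := hg
  rw [ContinuousAt, Metric.tendsto_nhds] at hx
  push Not at hx
  obtain ⟨e, he, hfr⟩ := hx
  have hfr' : ∃ᶠ y in 𝓝 x, g x + e ≤ g y ∨ g y ≤ g x - e := by
    refine hfr.mono fun y hy => ?_
    rw [Real.dist_eq, le_abs] at hy
    rcases hy with h | h
    · left; linarith
    · right; linarith
  rcases frequently_or_distrib.1 hfr' with h | h
  · obtain ⟨a, ha, ha'⟩ := exists_rat_btwn (show g x < g x + e by linarith)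
    obtain ⟨b, hb, hb'⟩ := exists_rat_btwn ha'
    refine ⟨(a + b) / 2, (b - a) / 2, ?_, x, false, ?_, h.mono fun y hy => ?_⟩
    · have : a < b := by exact_mod_cast hb
      linarith
    · rw [correctAnswer_false]; push_cast; linarith
    · rw [Bool.not_false, correctAnswer_true]; push_cast; linarith
  · obtain ⟨b, hb, hb'⟩ := exists_rat_btwn (show g x - e < g x by linarith)
    obtain ⟨a, ha, ha'⟩ := exists_rat_btwn hb
    refine ⟨(a + b) / 2, (b - a) / 2, ?_, x, true, ?_, h.mono fun y hy => ?_⟩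
    · have : a < b := by exact_mod_cast ha'
      linarith
    · rw [correctAnswer_true]; push_cast; linarith
    · rw [Bool.not_true, correctAnswer_false]; push_cast; linarith

/-- A single query to a discontinuous function decides membership in a closed set. -/
theorem exists_query_mem_closed {g : Cantor → ℝ} (hg : ¬ Continuous g) :
    ∃ q δ : ℚ, 0 < δ ∧ ∃ c, ∀ E : Set Cantor, IsClosed E → ∃ k : Cantor → Cantor, Continuous k ∧
      ∀ B σ, CorrectAnswer σ (g (k B)) q δ → (σ = c ↔ B ∈ E) := by
  obtain ⟨q, δ, hδ, x, b, hb, hfr⟩ := exists_frequently_refuted hg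
  refine ⟨q, δ, hδ, !b, fun E hE => ?_⟩
  obtain ⟨k, hk, hkE, -, hkR⟩ := exists_continuous_glue hE x
    (fun y _ => ¬ CorrectAnswer (!b) (g y) q δ) (fun A _ => ⟨univ, univ_mem, fun l => by
      obtain ⟨y, hy, hyl⟩ := (hfr.and_eventually
        ((PiNat.isOpen_cylinder _ x l).mem_nhds (PiNat.self_mem_cylinder x l))).exists
      exact ⟨fun _ => y, continuous_const, fun _ => hyl, fun _ _ => hy⟩⟩) 0
  refine ⟨k, hk, fun B σ hσ => ⟨fun h => ?_, fun h => ?_⟩⟩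
  · by_contra hB
    exact hkR B hB (h ▸ hσ)
  · rw [hkE B h] at hσ
    rw [Bool.eq_not]
    rintro rfl
    exact hb hσ

/-! ### From ranks to reductions -/

/-- The queries of a truth-table reduction may be indexed by any finite type. -/
theorem TTReducible.of_fintype {f g : Cantor → ℝ}
    (h : ∀ p ε : ℚ, 0 < ε → ∃ (ι : Type) (_ : Fintype ι) (q δ : ι → ℚ) (k : ι → Cantor → Cantor)
      (t : (ι → Bool) → Bool), (∀ i, 0 < δ i) ∧ (∀ i, Continuous (k i)) ∧
      ∀ (A : Cantor) (σ : ι → Bool),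
        (∀ i, CorrectAnswer (σ i) (g (k i A)) (q i) (δ i)) → CorrectAnswer (t σ) (f A) p ε) :
    TTReducible f g := by
  intro p ε hε
  obtain ⟨ι, _, q, δ, k, t, hδ, hk, ht⟩ := h p ε hε
  let e := Fintype.equivFin ι
  refine ⟨Fintype.card ι, fun i => q (e.symm i), fun i => δ (e.symm i), fun i => k (e.symm i),
    fun σ => t fun i => σ (e i), fun i => hδ _, fun i => hk _, fun A σ hσ => ht A _ fun i => ?_⟩
  simpa using hσ (e i)

/-- The derivation of `f` is cut into `n` blocks of length `δ₀`, a number of stages that the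
derivation of `g` survives. One query per block simulates `f` on it, and one further query per block
decides whether the input survives to the start of it. -/
theorem TTReducible.of_ordLesssim {f g : Cantor → ℝ} (hf : IsBaireOne f) (hg : IsBaireOne g)
    (hg' : ¬ Continuous g) (h : OrdLesssim (bourgainRank f) (bourgainRank g)) :
    TTReducible f g := by
  refine .of_fintype fun p ε hε => ?_
  obtain ⟨α, hα, hempty⟩ := hf.exists_succ_eq_empty p hε
  obtain ⟨δ₀, hδ₀, n, hn⟩ := h α hα
  obtain ⟨q, δ, hδ, x₀, hx₀⟩ := hg.exists_nonempty_of_lt hδ₀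
  obtain ⟨q', δ', hδ', c, hc⟩ := exists_query_mem_closed hg'
  let F : ℕ → Set Cantor := fun j => derivSeq (separatingSets f p ε) (δ₀ * (j : Ordinal.{0}))
  have hFn : F n = ∅ :=
    subset_empty_iff.1 (hempty ▸ derivSeq_antitone (Order.succ_le_of_lt hn))
  have hF : Antitone F := fun i j hij =>
    derivSeq_antitone (mul_le_mul_right (by exact_mod_cast hij) _)
  have hsim := fun j : ℕ => exists_simulation f g p ε q δ (δ₀ * (j : Ordinal.{0})) δ₀ x₀ hx₀ 0
  choose k hk _ _ hkR using hsim
  choose l hl hlE using fun j : ℕ => hc (F j) (isClosed_derivSeq _)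
  classical
  refine ⟨Fin n ⊕ Fin n, inferInstance, Sum.elim (fun _ => q) (fun _ => q'),
    Sum.elim (fun _ => δ) (fun _ => δ'), Sum.elim (fun j => k j) (fun j => l j),
    fun σ => decide (∃ j, σ (.inr j) = c ∧ (∀ i > j, σ (.inr i) ≠ c) ∧ σ (.inl j) = true),
    by rintro (j | j) <;> assumption, ?_, fun A σ hσ => ?_⟩
  · rintro (j | j)
    exacts [hk j, hl j]
  have hin : ∀ j : Fin n, σ (.inr j) = c ↔ A ∈ F j := fun j => hlE j A _ (hσ (.inr j))
  -- `j` is the last block that starts before `A` is removed.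
  obtain ⟨j, hjn, hj, hj'⟩ : ∃ j < n, A ∈ F j ∧ A ∉ F (j + 1) := by
    by_contra! hstep
    have : ∀ j ≤ n, A ∈ F j := by
      intro j
      induction j with
      | zero => intro _; simp [F, derivSeq_zero]
      | succ j ih => exact fun hj => hstep j hj (ih (Nat.le_of_succ_le hj))
    exact notMem_empty A (hFn ▸ this n le_rfl)
  have hlast : ∀ i : Fin n, i > ⟨j, hjn⟩ → σ (.inr i) ≠ c := fun i hi h =>
    hj' (hF (Nat.succ_le_of_lt hi) ((hin i).1 h))
  have hval : decide (∃ j, σ (.inr j) = c ∧ (∀ i > j, σ (.inr i) ≠ c) ∧ σ (.inl j) = true) =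
      σ (.inl ⟨j, hjn⟩) := by
    rw [Bool.eq_iff_iff, decide_eq_true_eq]
    constructor
    · rintro ⟨i, hi, hilast, h⟩
      rcases lt_trichotomy i ⟨j, hjn⟩ with hlt | rfl | hgt
      · exact absurd ((hin ⟨j, hjn⟩).2 hj) (hilast _ hlt)
      · exact h
      · exact absurd hi (hlast i hgt)
    · exact fun h => ⟨⟨j, hjn⟩, (hin _).2 hj, hlast, h⟩
  beta_reduce
  rw [hval]
  have hj'' : A ∉ derivSeq (separatingSets f p ε) (δ₀ * (j : Ordinal.{0}) + δ₀) := by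
    rw [← mul_add_one]
    exact_mod_cast hj'
  obtain ⟨b, hb, hb'⟩ := hkR j A hj'' hj
  have hσj := hσ (.inl ⟨j, hjn⟩)
  have : σ (.inl ⟨j, hjn⟩) = b := by
    rw [← Bool.not_not b, Bool.eq_not]
    intro h
    rw [h] at hσj
    exact hb' hσj
  rwa [this]

/-! ### Natural sums of ordinals -/

/-- The Hessenberg natural sum: the least operation that is strictly increasing in both
arguments. -/
noncomputable def natSum (a b : Ordinal.{0}) : Ordinal.{0} :=
  max (⨆ x : Iio a, succ (natSum x.1 b)) (⨆ y : Iio b, succ (natSum a y.1))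
termination_by (a, b)
decreasing_by
  · exact Prod.Lex.left _ _ x.2
  · exact Prod.Lex.right _ y.2

theorem natSum_le_iff {a b c : Ordinal.{0}} :
    natSum a b ≤ c ↔ (∀ a' < a, natSum a' b < c) ∧ ∀ b' < b, natSum a b' < c := by
  rw [natSum, max_le_iff, Ordinal.iSup_le_iff, Ordinal.iSup_le_iff]
  simp

theorem natSum_lt_left {a a' : Ordinal.{0}} (h : a' < a) (b : Ordinal.{0}) :
    natSum a' b < natSum a b :=
  (natSum_le_iff.1 le_rfl).1 a' h

theorem natSum_lt_right {b b' : Ordinal.{0}} (a : Ordinal.{0}) (h : b' < b) :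
    natSum a b' < natSum a b :=
  (natSum_le_iff.1 le_rfl).2 b' h

theorem natSum_le_natSum {a a' b b' : Ordinal.{0}} (ha : a' ≤ a) (hb : b' ≤ b) :
    natSum a' b' ≤ natSum a b :=
  (StrictMono.monotone (f := fun x => natSum x b') (fun _ _ h => natSum_lt_left h b') ha).trans
    (StrictMono.monotone (f := natSum a) (fun _ _ h => natSum_lt_right a h) hb)

theorem eq_and_eq_of_natSum_eq {a a' b b' : Ordinal.{0}} (ha : a' ≤ a) (hb : b' ≤ b)
    (h : natSum a' b' = natSum a b) : a' = a ∧ b' = b := by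
  refine ⟨ha.eq_of_not_lt fun hlt => ?_, hb.eq_of_not_lt fun hlt => ?_⟩
  · exact ((natSum_lt_left hlt b').trans_le (natSum_le_natSum le_rfl hb)).ne h
  · exact ((natSum_lt_right a' hlt).trans_le (natSum_le_natSum ha le_rfl)).ne h

theorem exists_nat_mul_add_of_lt_mul_omega0 {π a : Ordinal.{0}} (h : a < π * Ordinal.omega0) :
    ∃ (c : ℕ) (ρ : Ordinal.{0}), ρ < π ∧ a = π * c + ρ := by
  have hπ : π ≠ 0 := by rintro rfl; simp at h
  obtain ⟨c, hc⟩ := Ordinal.lt_omega0.1 ((Ordinal.lt_mul_iff_div_lt hπ).1 h)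
  exact ⟨c, a % π, Ordinal.mod_lt a hπ, by rw [← hc, Ordinal.div_add_mod]⟩

theorem mul_nat_add_lt {π ρ : Ordinal.{0}} (hρ : ρ < π) {c d : ℕ} (h : c < d) (τ : Ordinal.{0}) :
    π * (c : Ordinal.{0}) + ρ < π * (d : Ordinal.{0}) + τ := by
  calc π * (c : Ordinal.{0}) + ρ < π * (c : Ordinal.{0}) + π := by gcongr
    _ = π * ((c + 1 : ℕ) : Ordinal.{0}) := by push_cast; rw [mul_add_one]
    _ ≤ π * (d : Ordinal.{0}) := mul_le_mul_right (by exact_mod_cast h) _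
    _ ≤ π * (d : Ordinal.{0}) + τ := le_self_add

theorem le_of_mul_nat_add_lt {π ρ ρ' : Ordinal.{0}} (hρ : ρ < π) {c c' : ℕ}
    (h : π * (c' : Ordinal.{0}) + ρ' < π * (c : Ordinal.{0}) + ρ) :
    c' < c ∨ c' = c ∧ ρ' < ρ := by
  rcases lt_trichotomy c' c with hc | rfl | hc
  · exact Or.inl hc
  · exact Or.inr ⟨rfl, lt_of_add_lt_add_left h⟩
  · exact absurd h (mul_nat_add_lt hρ hc ρ').not_gt

/-- Natural sums are computed digitwise in base `π` when `π` is closed under them; only the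
inequality needed for closure of `π * ω` is stated. -/
theorem natSum_mul_add_le {π : Ordinal.{0}} (hπ : ∀ ρ < π, ∀ τ < π, natSum ρ τ < π) {c d : ℕ}
    {ρ τ : Ordinal.{0}} (hρ : ρ < π) (hτ : τ < π) :
    natSum (π * c + ρ) (π * d + τ) ≤ π * ((c + d : ℕ) : Ordinal.{0}) + natSum ρ τ := by
  obtain ⟨a, ha⟩ : ∃ a, a = π * (c : Ordinal.{0}) + ρ := ⟨_, rfl⟩
  obtain ⟨b, hb⟩ : ∃ b, b = π * (d : Ordinal.{0}) + τ := ⟨_, rfl⟩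
  have hlim : ∀ {c : ℕ} {ρ x : Ordinal.{0}}, ρ < π → x < π * (c : Ordinal.{0}) + ρ →
      ∃ (c' : ℕ) (ρ' : Ordinal.{0}), ρ' < π ∧ x = π * c' + ρ' := fun {c ρ x} hρ hx =>
    exists_nat_mul_add_of_lt_mul_omega0 <| hx.trans <| by
      calc π * (c : Ordinal.{0}) + ρ < π * ((c + 1 : ℕ) : Ordinal.{0}) + 0 :=
            mul_nat_add_lt hρ (Nat.lt_succ_self c) 0
        _ ≤ π * Ordinal.omega0 := by
            rw [add_zero]
            exact mul_le_mul_right (Ordinal.natCast_lt_omega0 _).le _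
  induction a using WellFoundedLT.induction generalizing b c d ρ τ with
  | ind a iha =>
  induction b using WellFoundedLT.induction generalizing d τ with
  | ind b ihb =>
  subst ha hb
  refine natSum_le_iff.2 ⟨fun a' ha' => ?_, fun b' hb' => ?_⟩
  · obtain ⟨c', ρ', hρ', rfl⟩ := hlim hρ ha'
    refine (iha _ ha' hρ' hτ rfl _ rfl).trans_lt ?_
    rcases le_of_mul_nat_add_lt hρ ha' with h | ⟨rfl, h⟩
    · exact mul_nat_add_lt (hπ _ hρ' _ hτ) (by omega) _
    · have := natSum_lt_left h τ
      gcongr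
  · obtain ⟨d', τ', hτ', rfl⟩ := hlim hτ hb'
    refine (ihb _ hb' hτ' rfl).trans_lt ?_
    rcases le_of_mul_nat_add_lt hτ hb' with h | ⟨rfl, h⟩
    · exact mul_nat_add_lt (hπ _ hρ _ hτ') (by omega) _
    · have := natSum_lt_right ρ h
      gcongr

/-- Powers of `ω` are closed under natural sums. -/
theorem natSum_lt_omega0_opow {ξ a b : Ordinal.{0}} (ha : a < Ordinal.omega0 ^ ξ)
    (hb : b < Ordinal.omega0 ^ ξ) : natSum a b < Ordinal.omega0 ^ ξ := by
  induction ξ using Ordinal.limitRecOn generalizing a b with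
  | zero =>
    rw [Ordinal.opow_zero, Order.lt_one_iff] at ha hb
    subst ha hb
    rw [Ordinal.opow_zero, Order.lt_one_iff, ← nonpos_iff_eq_zero, natSum_le_iff]
    simp
  | add_one ξ ih =>
    rw [Ordinal.opow_add_one] at ha hb ⊢
    obtain ⟨c, ρ, hρ, rfl⟩ := exists_nat_mul_add_of_lt_mul_omega0 ha
    obtain ⟨d, τ, hτ, rfl⟩ := exists_nat_mul_add_of_lt_mul_omega0 hb
    refine (natSum_mul_add_le (fun _ h _ h' => ih h h') hρ hτ).trans_lt ?_
    refine (mul_nat_add_lt (ih hρ hτ) (Nat.lt_succ_self _) 0).trans_le ?_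
    rw [add_zero]
    exact mul_le_mul_right (Ordinal.natCast_lt_omega0 _).le _
  | limit ξ hξ ih =>
    rw [Ordinal.lt_opow_of_isSuccLimit Ordinal.omega0_ne_zero hξ] at ha hb ⊢
    obtain ⟨η, hη, ha⟩ := ha
    obtain ⟨ζ, hζ, hb⟩ := hb
    have hpos := Ordinal.omega0_pos
    exact ⟨max η ζ, max_lt hη hζ, ih _ (max_lt hη hζ)
      (ha.trans_le (Ordinal.opow_le_opow_right hpos (le_max_left _ _)))
      (hb.trans_le (Ordinal.opow_le_opow_right hpos (le_max_right _ _)))⟩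

/-! ### From reductions to ranks -/

/-- Finitely many upper semicontinuous ordinal-valued functions with values below `ω^ξ` combine
into a single one, `N`, such that near any point `A` all of them keep their value wherever `N`
does. -/
theorem exists_combined_rank {X ι : Type*} [TopologicalSpace X] {ξ : Ordinal.{0}}
    (s : Finset ι) (ν : ι → X → Ordinal.{0}) (hν : ∀ i A, ν i A < Ordinal.omega0 ^ ξ)
    (husc : ∀ i A, ∀ᶠ B in 𝓝 A, ν i B ≤ ν i A) :
    ∃ N : X → Ordinal.{0}, (∀ A, N A < Ordinal.omega0 ^ ξ) ∧
      ∀ A, ∀ᶠ B in 𝓝 A, N B ≤ N A ∧ (N B = N A → ∀ i ∈ s, ν i B = ν i A) := by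
  classical
  induction s using Finset.induction_on with
  | empty =>
    exact ⟨fun _ => 0, fun _ => Ordinal.opow_pos _ Ordinal.omega0_pos, fun A => by simp⟩
  | insert i s _ ih =>
    obtain ⟨N, hN, hN'⟩ := ih
    refine ⟨fun A => natSum (ν i A) (N A), fun A => natSum_lt_omega0_opow (hν i A) (hN A),
      fun A => ?_⟩
    filter_upwards [hN' A, husc i A] with B hB hBi
    refine ⟨natSum_le_natSum hBi hB.1, fun h => ?_⟩
    obtain ⟨h1, h2⟩ := eq_and_eq_of_natSum_eq hBi hB.1 h
    exact Finset.forall_mem_insert _ _ _ |>.2 ⟨h1, hB.2 h2⟩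

/-- If `f ≤_tt g` and the derivations of `g` all stop by stage `ω^ξ`, then so do those of `f`.
The stages at which the points `k i A` are removed combine to a natural sum `N A < ω^ξ`; near `A`,
the points `B` with `N B = N A` have the same removal stages, so that a fixed tuple of answers is
correct at all of them, and therefore `A` does not survive `N A + 1` stages for `f`. -/
theorem TTReducible.bourgainRank_le {f g : Cantor → ℝ} (hf : IsBaireOne f) (hg : IsBaireOne g)
    (h : TTReducible f g) {ξ : Ordinal.{0}}
    (hgξ : bourgainRank g ≤ Ordinal.omega0 ^ ξ) : bourgainRank f ≤ Ordinal.omega0 ^ ξ := by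
  refine Ordinal.iSup_le fun ⟨p, ε, hε⟩ => ?_
  rw [hf.rankAt_le_iff hε]
  obtain ⟨r, q, δ, k, t, hδ, hk, ht⟩ := h p ε hε
  have hstage : ∀ i A, ∃ ν < bourgainRank g,
      k i A ∈ derivSeq (separatingSets g (q i) (δ i)) ν ∧
      k i A ∉ derivSeq (separatingSets g (q i) (δ i)) (succ ν) := fun i A =>
    exists_removal_stage (by rw [hg.derivSeq_bourgainRank _ (hδ i)]; exact notMem_empty _)
  choose ν hν hνmem hνnot using hstage
  have hle : ∀ i B μ, k i B ∉ derivSeq (separatingSets g (q i) (δ i)) (succ μ) → ν i B ≤ μ := by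
    intro i B μ hB
    by_contra! hlt
    exact hB (derivSeq_antitone (succ_le_of_lt hlt) (hνmem i B))
  have husc : ∀ i A, ∀ᶠ B in 𝓝 A, ν i B ≤ ν i A := by
    intro i A
    filter_upwards [(hk i).continuousAt.eventually
      ((isClosed_derivSeq _).isOpen_compl.mem_nhds (hνnot i A))] with B hB
    exact hle i B _ hB
  obtain ⟨N, hN, hN'⟩ := exists_combined_rank Finset.univ ν (fun i A => (hν i A).trans_le hgξ) husc
  have hanswer : ∀ i A, ∃ b, ∀ᶠ B in 𝓝 A, ν i B = ν i A →
      CorrectAnswer b (g (k i B)) (q i) (δ i) := by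
    intro i A
    have hnot := hνnot i A
    rw [derivSeq_succ, mem_derive_iff] at hnot
    push Not at hnot
    obtain ⟨b, hb⟩ := hnot (hνmem i A)
    refine ⟨b, ((hk i).continuousAt.eventually hb).mono fun B hB heq => hB ?_⟩
    rw [← heq]
    exact hνmem i B
  choose b hb using hanswer
  have hremoved : ∀ (η : Ordinal.{0}) (A : Cantor), N A = η →
      A ∉ derivSeq (separatingSets f p ε) (succ η) := by
    intro η
    induction η using WellFoundedLT.induction with
    | ind η ih =>
    intro A hA hmem
    rw [derivSeq_succ, mem_derive_iff] at hmem
    have hev : ∀ᶠ B in 𝓝 A, ∀ i, ν i B = ν i A →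
        CorrectAnswer (b i A) (g (k i B)) (q i) (δ i) := eventually_all.2 fun i => hb i A
    obtain ⟨B, ⟨hB, hBn⟩, hBN, hBans⟩ :=
      ((hmem.2 (t fun i => b i A)).and_eventually ((hN' A).and hev)).exists
    have heq : N B = N A := by
      refine hBN.1.eq_of_not_lt fun hlt => ?_
      rw [hA] at hlt
      exact ih _ hlt B rfl (derivSeq_antitone (succ_le_of_lt hlt) hB)
    exact hBn (ht B _ fun i => hBans i (hBN.2 heq i (Finset.mem_univ i)))
  refine eq_empty_of_forall_notMem fun A hA => hremoved _ A rfl (derivSeq_antitone ?_ hA)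
  exact succ_le_of_lt (hN A)

/-! ### Levels of the rank hierarchy -/

theorem one_lt_bourgainRank {g : Cantor → ℝ} (hg : IsBaireOne g) (hg' : ¬ Continuous g) :
    1 < bourgainRank g := by
  obtain ⟨q, δ, hδ, x, b, hb, hfr⟩ := exists_frequently_refuted hg'
  by_contra! hle
  have hempty := (hg.rankAt_le_iff hδ).1 ((rankAt_le_bourgainRank g q hδ).trans hle)
  refine notMem_empty x (hempty ▸ ?_)
  rw [← zero_add (1 : Ordinal.{0}), ← succ_eq_add_one, derivSeq_succ, derivSeq_zero, mem_derive_iff]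
  refine ⟨mem_univ x, fun c => ?_⟩
  simp only [mem_univ, true_and]
  rcases Bool.eq_or_eq_not c b with rfl | rfl
  · exact fun h => hb (not_not.1 h.self_of_nhds)
  · exact hfr

/-- `ξ(f)` depends on the rank `α = |f|_α` only; this is the function of `α` it is given by. -/
noncomputable def level (α : Ordinal.{0}) : Ordinal.{0} :=
  sInf {ξ : Ordinal.{0} | α ≤ Ordinal.omega0 ^ ξ}

theorem level_le_iff {α ξ : Ordinal.{0}} : level α ≤ ξ ↔ α ≤ Ordinal.omega0 ^ ξ := by
  refine ⟨fun h => ?_, fun h => csInf_le' h⟩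
  have : α ≤ Ordinal.omega0 ^ level α :=
    csInf_mem (s := {ξ : Ordinal.{0} | α ≤ Ordinal.omega0 ^ ξ})
      ⟨α, Ordinal.right_le_opow α Ordinal.one_lt_omega0⟩
  exact this.trans (Ordinal.opow_le_opow_right Ordinal.omega0_pos h)

theorem ordLesssim_iff_le_opow_level {α β : Ordinal.{0}} (hβ : 1 < β) :
    OrdLesssim α β ↔ α ≤ Ordinal.omega0 ^ level β := by
  have hlevel : level β ≠ 0 := by
    intro h
    have := level_le_iff.1 h.le
    rw [Ordinal.opow_zero] at this
    exact hβ.not_ge this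
  have hβle : β ≤ Ordinal.omega0 ^ level β := level_le_iff.1 le_rfl
  constructor
  · intro h
    refine le_of_forall_lt fun γ hγ => ?_
    obtain ⟨δ, hδ, n, hn⟩ := h γ hγ
    exact hn.trans ((Ordinal.isPrincipal_add_omega0_opow _).mul_natCast_lt (hδ.trans_le hβle) n)
  · intro h γ hγ
    have hγ' := hγ.trans_le h
    rcases Ordinal.zero_or_succ_or_isSuccLimit (level β) with h0 | ⟨η, hη⟩ | hlim
    · exact absurd h0 hlevel
    · have hηβ : Ordinal.omega0 ^ η < β := by
        rw [← not_le, ← level_le_iff, ← hη, not_le]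
        exact lt_succ η
      rw [← hη, Ordinal.opow_succ, Ordinal.lt_mul_iff_of_isSuccLimit Ordinal.isSuccLimit_omega0]
        at hγ'
      obtain ⟨c, hc, hγc⟩ := hγ'
      obtain ⟨n, rfl⟩ := Ordinal.lt_omega0.1 hc
      exact ⟨_, hηβ, n, hγc⟩
    · obtain ⟨η, hη, hγη⟩ := (Ordinal.lt_opow_of_isSuccLimit Ordinal.omega0_ne_zero hlim).1 hγ'
      refine ⟨Ordinal.omega0 ^ η, ?_, 1, by simpa using hγη⟩
      rwa [← not_le, ← level_le_iff, not_le]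

end Bourgain

theorem mainTheorem2 (f g : Bourgain.Cantor → ℝ)
    (hf : Bourgain.IsBaireOne f) (hf' : ¬ Continuous f)
    (hg : Bourgain.IsBaireOne g) (hg' : ¬ Continuous g) :
    (Bourgain.TTReducible f g ↔
      Bourgain.OrdLesssim (Bourgain.bourgainRank f) (Bourgain.bourgainRank g)) ∧
    (Bourgain.TTReducible f g ↔ Bourgain.bourgainLevel f ≤ Bourgain.bourgainLevel g) := by
  have hlesssim := Bourgain.ordLesssim_iff_le_opow_level (α := Bourgain.bourgainRank f)
    (Bourgain.one_lt_bourgainRank hg hg')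
  have htt : Bourgain.TTReducible f g ↔
      Bourgain.OrdLesssim (Bourgain.bourgainRank f) (Bourgain.bourgainRank g) :=
    ⟨fun h => hlesssim.2 (h.bourgainRank_le hf hg (Bourgain.level_le_iff.1 le_rfl)),
      Bourgain.TTReducible.of_ordLesssim hf hg hg'⟩
  exact ⟨htt, htt.trans (hlesssim.trans Bourgain.level_le_iff.symm)⟩
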